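/- Let $\mathcal A\subseteq B(H)$ be a von Neumann algebra on a complex Hilbert space $H$ (with $\mathbb 1_H\in\mathcal A$). A *normal state* on $\mathcal A$ is a linear functional $\varphi(x)=\operatorname{tr}(\rho x)$, where $\rho\ge 0$ is a trace class operator on $H$ with $\operatorname{tr}\rho=1$; its *support* $\operatorname{supp}\varphi$ is the smallest orthogonal projection $p\in\mathcal A$ such that $\varphi(x)=\varphi(pxp)$ for all $x\in\mathcal A$. A *Markov operator* on $\mathcal A$ is a completely positive linear map $P:\mathcal A\to\mathcal A$ which is unital ($P(\mathbb 1)=\mathbb 1$) and normal, i.e. $\varphi\circ P$ is a normal state for every normal state $\varphi$ on $\mathcal A$. A normal state $\varphi$ is *stationary* for $P$ if $\varphi\circ P=\varphi$. An orthogonal projection $p\in\mathcal A$ is *positive recurrent* if $p\le\bigvee_{i\in I}\operatorname{supp}\varphi_i$ for some family $(\varphi_i)_{i\in I}$ of stationary normal states, and $p_{\mathrm R}\in\mathcal A$ denotes the supremum of all positive recurrent projections. **Theorem.** Let $P:\mathcal A\to\mathcal A$ be a Markov operator with $P^2=P$ such that $p_{\mathrm R}P(\mathcal A)p_{\mathrm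 R}$ is finite dimensional and commutative. Then $P$ has a Holevo representation: there are $n\in\mathbb N_0$, normal states $\varphi_1,\dots,\varphi_n$ on $\mathcal A$ and positive elements $a_1,\dots,a_n\in\mathcal A$ with $\sum_{i=1}^n a_i=\mathbb 1$ such that $$P(x)=\sum_{i=1}^n\varphi_i(x)\,a_i\qquad\text{for all }x\in\mathcal A.$$ Moreover, these can be chosen such that $a_1,\dots,a_n$ are linearly independent and $\varphi_1,\dots,\varphi_n$ are linearly independent. -/

import Mathlib

universe u

open scoped InnerProductSpace CStarAlgebra

noncomputable section

variable {H : Type u} [NormedAddCommGroup H] [InnerProductSpace ℂ H] [CompleteSpace H]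

/-! ### A von Neumann algebra as an ordered C⋆-algebra

Elements of `A : VonNeumannAlgebra H` are compared in the order of operators on `H`
(`x ≤ y` iff `y - x` is a positive operator), which `↥A` inherits as a subtype. -/

instance VonNeumannAlgebra.instSMulMemClassComplex :
    SMulMemClass (VonNeumannAlgebra H) ℂ (H →L[ℂ] H) where
  smul_mem {A} c _ hx := SMulMemClass.smul_mem (s := A.toStarSubalgebra) c hx

instance VonNeumannAlgebra.instIsClosedCoe (A : VonNeumannAlgebra H) :
    IsClosed (A : Set (H →L[ℂ] H)) := by
  rw [← A.centralizer_centralizer]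
  exact Set.isClosed_centralizer _

theorem VonNeumannAlgebra.sqrt_mem (A : VonNeumannAlgebra H) {x : H →L[ℂ] H} (hx : x ∈ A) :
    CFC.sqrt x ∈ A := by
  rw [← A.commutant_commutant, VonNeumannAlgebra.mem_commutant_iff]
  intro y hy
  have h : Commute x y := VonNeumannAlgebra.mem_commutant_iff.1 hy x hx
  exact (h.cfcₙ_nnreal _).symm

instance VonNeumannAlgebra.instStarOrderedRingCoe (A : VonNeumannAlgebra H) :
    StarOrderedRing A := by
  refine StarOrderedRing.of_nonneg_iff' (fun {x y} hxy z => ?_) (fun x => ⟨fun hx => ?_, ?_⟩)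
  · exact add_le_add_right (α := H →L[ℂ] H) hxy z
  · have hx' : (0 : H →L[ℂ] H) ≤ x := hx
    have hs : (0 : H →L[ℂ] H) ≤ CFC.sqrt (x : H →L[ℂ] H) := CFC.sqrt_nonneg _
    refine ⟨⟨CFC.sqrt (x : H →L[ℂ] H), A.sqrt_mem x.2⟩, Subtype.ext ?_⟩
    change (x : H →L[ℂ] H) = star (CFC.sqrt (x : H →L[ℂ] H)) * CFC.sqrt (x : H →L[ℂ] H)
    rw [(IsSelfAdjoint.of_nonneg hs).star_eq, CFC.sqrt_mul_sqrt_self _ hx']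
  · rintro ⟨s, rfl⟩
    exact star_mul_self_nonneg (s : H →L[ℂ] H)

/-! ### The complete lattice of orthogonal projections of a von Neumann algebra -/

/-- The orthogonal projections belonging to `A`, ordered as operators. -/
abbrev VonNeumannAlgebra.Proj (A : VonNeumannAlgebra H) : Type u := {p : A // IsStarProjection p}

/-- The closed linear span of the ranges of a set of orthogonal projections. -/
def VonNeumannAlgebra.Proj.spanRange {A : VonNeumannAlgebra H} (S : Set A.Proj) :
    Submodule ℂ H :=
  (⨆ p ∈ S, ((p : A) : H →L[ℂ] H).range).topologicalClosure

instance {A : VonNeumannAlgebra H} (S : Set A.Proj) :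
    (VonNeumannAlgebra.Proj.spanRange S).HasOrthogonalProjection := by
  have : CompleteSpace (VonNeumannAlgebra.Proj.spanRange S) :=
    (Submodule.isClosed_topologicalClosure _).completeSpace_coe
  infer_instance

theorem VonNeumannAlgebra.Proj.isStarProjection_coe {A : VonNeumannAlgebra H} (p : A.Proj) :
    IsStarProjection ((p : A) : H →L[ℂ] H) :=
  ⟨congrArg Subtype.val p.2.isIdempotentElem, congrArg Subtype.val p.2.isSelfAdjoint⟩

theorem VonNeumannAlgebra.Proj.starProjection_spanRange_mem {A : VonNeumannAlgebra H}
    (S : Set A.Proj) : (spanRange S).starProjection ∈ A := by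
  rw [VonNeumannAlgebra.IsStarProjection.mem_iff isStarProjection_starProjection]
  intro y hy
  rw [Submodule.range_starProjection, Module.End.mem_invtSubmodule]
  have h : (⨆ p ∈ S, ((p : A) : H →L[ℂ] H).range) ≤ (spanRange S).comap (y : H →ₗ[ℂ] H) := by
    refine iSup₂_le fun p hp => ?_
    rintro _ ⟨v, rfl⟩
    refine Submodule.le_topologicalClosure _ (le_iSup₂ (f := fun (p : A.Proj) (_ : p ∈ S) =>
      ((p : A) : H →L[ℂ] H).range) p hp ⟨y v, ?_⟩)
    exact congrArg (fun T : H →L[ℂ] H => T v)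
      (VonNeumannAlgebra.mem_commutant_iff.1 hy ((p : A) : H →L[ℂ] H) p.1.2)
  exact Submodule.topologicalClosure_minimal _ h
    ((Submodule.isClosed_topologicalClosure _).preimage y.continuous)

theorem VonNeumannAlgebra.Proj.le_iff_range_le {A : VonNeumannAlgebra H} (p q : A.Proj) :
    p ≤ q ↔ ((p : A) : H →L[ℂ] H).range ≤ ((q : A) : H →L[ℂ] H).range := by
  obtain ⟨_, hp⟩ := isStarProjection_iff_eq_starProjection_range.1 p.isStarProjection_coe
  obtain ⟨_, hq⟩ := isStarProjection_iff_eq_starProjection_range.1 q.isStarProjection_coe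
  rw [← Submodule.starProjection_le_starProjection_iff, ← hp, ← hq]
  rfl

/-- The supremum of a set of orthogonal projections of `A` is the orthogonal projection onto the
closed linear span of their ranges. -/
instance VonNeumannAlgebra.Proj.instSupSet (A : VonNeumannAlgebra H) : SupSet A.Proj where
  sSup S := ⟨⟨(spanRange S).starProjection, starProjection_spanRange_mem S⟩,
    ⟨Subtype.ext isStarProjection_starProjection.isIdempotentElem,
      Subtype.ext isStarProjection_starProjection.isSelfAdjoint⟩⟩

theorem VonNeumannAlgebra.Proj.range_sSup {A : VonNeumannAlgebra H} (S : Set A.Proj) :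
    ((sSup S : A.Proj).1 : H →L[ℂ] H).range = spanRange S :=
  Submodule.range_starProjection _

theorem VonNeumannAlgebra.Proj.isLUB_sSup {A : VonNeumannAlgebra H} (S : Set A.Proj) :
    IsLUB S (sSup S) := by
  refine ⟨fun p hp => ?_, fun q hq => ?_⟩
  · rw [le_iff_range_le, range_sSup]
    exact (le_iSup₂ (f := fun (p : A.Proj) (_ : p ∈ S) =>
      ((p : A) : H →L[ℂ] H).range) p hp).trans (Submodule.le_topologicalClosure _)
  · rw [le_iff_range_le, range_sSup]
    obtain ⟨_, h⟩ := isStarProjection_iff_eq_starProjection_range.1 q.isStarProjection_coe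
    refine Submodule.topologicalClosure_minimal _
      (iSup₂_le fun p hp => (le_iff_range_le p q).1 (hq hp)) ?_
    exact ContinuousLinearMap.IsIdempotentElem.isClosed_range q.isStarProjection_coe.isIdempotentElem

instance VonNeumannAlgebra.Proj.instCompleteLattice (A : VonNeumannAlgebra H) :
    CompleteLattice A.Proj :=
  completeLatticeOfSup A.Proj VonNeumannAlgebra.Proj.isLUB_sSup

/-! ### Normal states -/

/-- `T` has the trace `c`: in every orthonormal basis `b` the series `∑ ⟪b i, T (b i)⟫`
converges (unconditionally) to `c`. -/
def HasTrace (T : H →L[ℂ] H) (c : ℂ) : Prop :=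
  ∀ (ι : Type u) (b : HilbertBasis ι ℂ H), HasSum (fun i => ⟪b i, T (b i)⟫_ℂ) c

/-- A density operator: a positive trace class operator of trace one. (A positive operator whose
diagonal series converges in an orthonormal basis is of trace class.) -/
def IsDensityOperator (ρ : H →L[ℂ] H) : Prop := 0 ≤ ρ ∧ HasTrace ρ 1

variable {A : VonNeumannAlgebra H}

/-- A normal state on `A`: a linear functional of the form `φ(x) = tr(ρ x)` for some density
operator `ρ` on `H`. -/
def IsNormalState (φ : A →ₗ[ℂ] ℂ) : Prop :=
  ∃ ρ : H →L[ℂ] H, IsDensityOperator ρ ∧ ∀ x : A, HasTrace (ρ * (x : H →L[ℂ] H)) (φ x)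

/-- The support of `φ`: the smallest orthogonal projection `p ∈ A` such that `φ(x) = φ(p x p)` for
all `x ∈ A`, written as the infimum of these projections (for a normal state the infimum is
attained). -/
def stateSupport (φ : A →ₗ[ℂ] ℂ) : A.Proj :=
  sInf {p : A.Proj | ∀ x : A, φ x = φ ((p : A) * x * (p : A))}

/-! ### Markov operators -/

/-- A Markov operator on `A`: a completely positive map that is unital and normal, the latter
meaning that `φ ∘ T` is a normal state for every normal state `φ`. -/
structure IsMarkov (T : A →CP A) : Prop where
  map_one : T 1 = 1
  normal : ∀ φ : A →ₗ[ℂ] ℂ, IsNormalState φ → IsNormalState (φ ∘ₗ T.toLinearMap)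

/-- A stationary normal state of `T`. -/
def IsStationaryState (T : A →CP A) (φ : A →ₗ[ℂ] ℂ) : Prop :=
  IsNormalState φ ∧ ∀ x : A, φ (T x) = φ x

/-- An orthogonal projection `p ∈ A` is positive recurrent if it is dominated by the supremum of the
supports of some family of stationary normal states. -/
def IsPositiveRecurrent (T : A →CP A) (p : A.Proj) : Prop :=
  ∃ Φ : Set (A →ₗ[ℂ] ℂ), (∀ φ ∈ Φ, IsStationaryState T φ) ∧ p ≤ ⨆ φ ∈ Φ, stateSupport φ

/-- The maximal positive recurrent projection `p_R`: the supremum of all positive recurrent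
projections. -/
def maxPositiveRecurrent (T : A →CP A) : A.Proj := sSup {p | IsPositiveRecurrent T p}

/-- The subspace `p_R T(A) p_R = {p_R T(x) p_R | x ∈ A}` of `A`. -/
def compressedRange (T : A →CP A) : Submodule ℂ A :=
  (LinearMap.range T.toLinearMap).map
    (LinearMap.mulLeftRight ℂ ((maxPositiveRecurrent T : A), (maxPositiveRecurrent T : A)))

/-- `T(x) = ∑ φ_i(x) a_i` is a Holevo representation of `T`: the `φ_i` are normal states and the
`a_i` are positive elements of `A` with `∑ a_i = 1`. -/
structure IsHolevoRepresentation (T : A →CP A) {n : ℕ} (φ : Fin n → (A →ₗ[ℂ] ℂ)) (a : Fin n → A) :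
    Prop where
  normalState : ∀ i, IsNormalState (φ i)
  nonneg : ∀ i, 0 ≤ a i
  sum_eq_one : ∑ i, a i = 1
  apply_eq : ∀ x : A, T x = ∑ i, φ i x • a i

end

/-! Write p for p_R. For every normal state ψ, idempotence makes ψ ∘ P stationary, so it lives on p;
hence P(pxp) = P(x) (`IsMarkov.apply_compress`). Thus P loses nothing on passing to B = pP(A)p, and
compressing P(b) recovers b for b in B.

The central point is that B is closed under the product of A. For self-adjoint b in B, the Schwarz
inequality gives y = pP(b²)p - b² ≥ 0, while P(y) = 0. All stationary states therefore vanish on y,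
and since they are jointly faithful on the corner (`mul_maxPositiveRecurrent_eq_zero`), y = 0 and b²
lies in B. Polarization, using commutativity, gives all products.

So B is a finite-dimensional commutative C⋆-algebra with unit p, spanned by orthogonal projections
e_i. Expanding pP(x)p = ∑ φ_i(x) e_i and applying P yields P(x) = ∑ φ_i(x) P(e_i). -/

/-! ### Finite-dimensional reduced commutative algebras -/

/-- A reduced Artinian ring is the product of its residue fields, and each of these is K because K
is algebraically closed; the standard basis of the product is transported back. -/
theorem exists_basis_orthogonal_idempotents (K R : Type*) [Field K] [IsAlgClosed K] [CommRing R]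
    [Algebra K R] [FiniteDimensional K R] [IsReduced R] :
    ∃ (n : ℕ) (e : Module.Basis (Fin n) K R),
      (∀ i j, e i * e j = if i = j then e i else 0) ∧ ∑ i, e i = 1 := by
  classical
  have : IsArtinianRing R := IsArtinianRing.of_finite K R
  have hbij (I : MaximalSpectrum R) : Function.Bijective (Algebra.ofId K (R ⧸ I.asIdeal)) :=
    IsAlgClosed.algebraMap_bijective_of_isIntegral
  let f : R ≃ₐ[K] (MaximalSpectrum R → K) :=
    ((IsArtinianRing.equivPi R).restrictScalars K).trans
      (AlgEquiv.piCongrRight fun I => (AlgEquiv.ofBijective _ (hbij I)).symm)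
  have := Fintype.ofFinite (MaximalSpectrum R)
  let k := Fintype.equivFin (MaximalSpectrum R)
  let e := ((Pi.basisFun K (MaximalSpectrum R)).map f.symm.toLinearEquiv).reindex k
  have he (i) : e i = f.symm (Pi.single (k.symm i) 1) := by simp [e]
  refine ⟨_, e, fun i j => ?_, ?_⟩
  · rw [he, he, ← map_mul]
    split_ifs with h
    · subst h
      rw [← Pi.single_mul, one_mul]
    · rw [← map_zero f.symm]
      congr 1
      ext I
      simp only [Pi.mul_apply, Pi.single_apply, Pi.zero_apply]
      have : k.symm i ≠ k.symm j := fun h' => h (k.symm.injective h')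
      grind
  · simp_rw [he, ← map_sum]
    rw [Equiv.sum_comp k.symm (fun I => (Pi.single I 1 : MaximalSpectrum R → K)),
      Finset.univ_sum_single (fun _ => (1 : K))]
    exact map_one f.symm

/-! ### Vector decompositions of normal states -/

section Trace

variable {H : Type u} [NormedAddCommGroup H] [InnerProductSpace ℂ H]

theorem HilbertBasis.hasSum_norm_inner_sq {ι : Type*} (b : HilbertBasis ι ℂ H) (v : H) :
    HasSum (fun i => ‖⟪b i, v⟫_ℂ‖ ^ 2) (‖v‖ ^ 2) := by
  have h := b.hasSum_inner_mul_inner v v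
  rw [inner_self_eq_norm_sq_to_K, ← RCLike.ofReal_pow] at h
  refine Complex.hasSum_ofReal.1 (Eq.mp (congrArg (HasSum · _) (funext fun i => ?_)) h)
  rw [← inner_conj_symm v, Complex.ofReal_pow, ← Complex.conj_mul']

variable [CompleteSpace H]

/-- Cyclicity tr(s s x) = tr(s x s) for Hilbert–Schmidt s: both sides are iterated sums, by rows and
by columns, of one double series `F`. -/
theorem HilbertBasis.hasSum_inner_sandwich {ι : Type*} (b : HilbertBasis ι ℂ H)
    {s : H →L[ℂ] H} (hs : IsSelfAdjoint s) (hsum : Summable fun i => ‖s (b i)‖ ^ 2)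
    (x : H →L[ℂ] H) {c : ℂ} (hc : HasSum (fun i => ⟪b i, (s * s * x) (b i)⟫_ℂ) c) :
    HasSum (fun i => ⟪s (b i), x (s (b i))⟫_ℂ) c := by
  have hs' (v w : H) : ⟪s v, w⟫_ℂ = ⟪v, s w⟫_ℂ := hs.isSymmetric v w
  let F : ι × ι → ℂ := fun q => ⟪s (b q.1), b q.2⟫_ℂ * ⟪b q.2, s (x (b q.1))⟫_ℂ
  have h1 : Summable fun q : ι × ι => ‖⟪s (b q.1), b q.2⟫_ℂ‖ ^ 2 := by
    rw [summable_prod_of_nonneg fun _ => sq_nonneg _]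
    have h (i) : HasSum (fun j => ‖⟪s (b i), b j⟫_ℂ‖ ^ 2) (‖s (b i)‖ ^ 2) := by
      simpa only [norm_inner_symm] using b.hasSum_norm_inner_sq (s (b i))
    exact ⟨fun i => (h i).summable, by simpa only [(h _).tsum_eq] using hsum⟩
  have h2 : Summable fun q : ι × ι => ‖⟪b q.2, s (x (b q.1))⟫_ℂ‖ ^ 2 := by
    rw [← (Equiv.prodComm ι ι).summable_iff]
    rw [summable_prod_of_nonneg fun _ => by exact sq_nonneg _]
    have h (j) : HasSum (fun i => ‖⟪b j, s (x (b i))⟫_ℂ‖ ^ 2) (‖x.adjoint (s (b j))‖ ^ 2) := by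
      convert b.hasSum_norm_inner_sq (x.adjoint (s (b j))) using 3 with i
      rw [norm_inner_symm (b i), ContinuousLinearMap.adjoint_inner_left, hs']
    refine ⟨fun j => (h j).summable, ?_⟩
    simp only [Function.comp_def, Equiv.prodComm_apply, Prod.swap, (h _).tsum_eq]
    refine .of_nonneg_of_le (fun _ => sq_nonneg _) (fun j => ?_) (hsum.mul_left (‖x.adjoint‖ ^ 2))
    rw [← mul_pow]
    gcongr
    exact x.adjoint.le_opNorm _
  -- Each term is a product of two square-summable families, so |uv| ≤ |u|² + |v|² gives absolute
  -- convergence.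
  have hF : Summable F := by
    refine .of_norm_bounded (h1.add h2) fun q => ?_
    simp only [F, norm_mul]
    nlinarith [sq_nonneg (‖⟪s (b q.1), b q.2⟫_ℂ‖ - ‖⟪b q.2, s (x (b q.1))⟫_ℂ‖),
      sq_nonneg ‖⟪s (b q.1), b q.2⟫_ℂ‖, sq_nonneg ‖⟪b q.2, s (x (b q.1))⟫_ℂ‖]
  obtain ⟨t, ht⟩ := hF
  have hrow := ht.prod_fiberwise fun i => b.hasSum_inner_mul_inner (s (b i)) (s (x (b i)))
  have hcol := ((Equiv.prodComm ι ι).hasSum_iff.2 ht).prod_fiberwise (g := fun j =>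
    ⟪s (b j), x (s (b j))⟫_ℂ) fun j => by
      rw [← ContinuousLinearMap.adjoint_inner_left]
      refine Eq.mp (congrArg (HasSum · _) (funext fun i => ?_))
        (b.hasSum_inner_mul_inner (x.adjoint (s (b j))) (s (b j)))
      simp only [Function.comp_apply, Equiv.prodComm_apply, Prod.swap, F,
        ContinuousLinearMap.adjoint_inner_left, hs']
      ring
  have : t = c := hrow.unique (by simpa [hs'] using hc)
  exact this ▸ hcol

variable {A : VonNeumannAlgebra H}

/-- Every normal state is a sum of vector functionals. -/
theorem IsNormalState.exists_hasSum_inner {φ : A →ₗ[ℂ] ℂ} (hφ : IsNormalState φ) :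
    ∃ (ι : Type u) (v : ι → H), ∀ x : A, HasSum (fun i => ⟪v i, (x : H →L[ℂ] H) (v i)⟫_ℂ) (φ x) := by
  obtain ⟨ρ, ⟨hρ, htr⟩, hx⟩ := hφ
  obtain ⟨w, b, -⟩ := exists_hilbertBasis ℂ H
  have hs : IsSelfAdjoint (CFC.sqrt ρ) := .of_nonneg (CFC.sqrt_nonneg ρ)
  have hss : CFC.sqrt ρ * CFC.sqrt ρ = ρ := CFC.sqrt_mul_sqrt_self ρ hρ
  have hsum : Summable fun i => ‖CFC.sqrt ρ (b i)‖ ^ 2 := by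
    have h := (htr _ b).summable
    rw [← Complex.summable_ofReal]
    convert h using 2 with i
    conv_rhs => rw [← hss, mul_apply_eq_comp]
    refine Eq.trans ?_ (hs.isSymmetric (b i) (CFC.sqrt ρ (b i)))
    rw [ContinuousLinearMap.coe_coe, inner_self_eq_norm_sq_to_K]
    simp
  exact ⟨w, fun i => CFC.sqrt ρ (b i), fun x => b.hasSum_inner_sandwich hs hsum x
    (by rw [hss]; exact hx x _ b)⟩

/-- The vector functional `x ↦ ⟪v, x v⟫` on `A`. -/
noncomputable def VonNeumannAlgebra.vectorFunctional (A : VonNeumannAlgebra H) (v : H) :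
    A →ₗ[ℂ] ℂ where
  toFun x := ⟪v, (x : H →L[ℂ] H) v⟫_ℂ
  map_add' x y := by
    change ⟪v, (x : H →L[ℂ] H) v + (y : H →L[ℂ] H) v⟫_ℂ = _
    rw [inner_add_right]
  map_smul' c x := by
    change ⟪v, c • (x : H →L[ℂ] H) v⟫_ℂ = _
    rw [inner_smul_right]; rfl

theorem VonNeumannAlgebra.isNormalState_vectorFunctional (A : VonNeumannAlgebra H) {v : H}
    (hv : ‖v‖ = 1) : IsNormalState (A.vectorFunctional v) := by
  have key (x : H →L[ℂ] H) : HasTrace (InnerProductSpace.rankOne ℂ v v * x) ⟪v, x v⟫_ℂ := by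
    intro ι b
    rw [← ContinuousLinearMap.adjoint_inner_left]
    refine Eq.mp (congrArg (HasSum · _) (funext fun i => ?_)) (b.hasSum_inner_mul_inner (x.adjoint v) v)
    simp [ContinuousLinearMap.adjoint_inner_left]
  refine ⟨InnerProductSpace.rankOne ℂ v v, ⟨?_, ?_⟩, fun x => key x⟩
  · rw [ContinuousLinearMap.nonneg_iff_isPositive]
    exact InnerProductSpace.isPositive_rankOne_self v
  · have := key 1
    rwa [mul_one, one_apply_eq_self, inner_self_eq_norm_sq_to_K, hv,
      RCLike.ofReal_one, one_pow] at this

end Trace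

/-! ### Supports and recurrence -/

section Support

open scoped ComplexOrder

variable {H : Type u} [NormedAddCommGroup H] [InnerProductSpace ℂ H] [CompleteSpace H]
  {A : VonNeumannAlgebra H}

theorem VonNeumannAlgebra.apply_eq_zero_of_inner_eq_zero {y : A} (hy : 0 ≤ y) {v : H}
    (h : ⟪v, (y : H →L[ℂ] H) v⟫_ℂ = 0) : (y : H →L[ℂ] H) v = 0 := by
  have hs : IsSelfAdjoint (CFC.sqrt (y : H →L[ℂ] H)) := .of_nonneg (CFC.sqrt_nonneg _)
  have hss : CFC.sqrt (y : H →L[ℂ] H) * CFC.sqrt (y : H →L[ℂ] H) = y := CFC.sqrt_mul_sqrt_self _ hy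
  rw [← hss, mul_apply_eq_comp] at h ⊢
  have h' := (hs.isSymmetric v (CFC.sqrt (y : H →L[ℂ] H) v)).trans h
  rw [ContinuousLinearMap.coe_coe, inner_self_eq_zero] at h'
  rw [h', map_zero]

theorem VonNeumannAlgebra.inner_apply_nonneg {y : A} (hy : 0 ≤ y) (v : H) :
    0 ≤ ⟪v, (y : H →L[ℂ] H) v⟫_ℂ :=
  ((ContinuousLinearMap.nonneg_iff_isPositive _).1 hy).inner_nonneg_right v

theorem VonNeumannAlgebra.Proj.apply_eq_iff_mem_range (p : A.Proj) {v : H} :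
    ((p : A) : H →L[ℂ] H) v = v ↔ v ∈ ((p : A) : H →L[ℂ] H).range := by
  refine ⟨fun h => ⟨v, h⟩, ?_⟩
  rintro ⟨w, rfl⟩
  exact congrArg (fun T : H →L[ℂ] H => T w) p.isStarProjection_coe.isIdempotentElem

theorem VonNeumannAlgebra.Proj.apply_eq_of_le {p q : A.Proj} (h : p ≤ q) {v : H}
    (hv : ((p : A) : H →L[ℂ] H) v = v) : ((q : A) : H →L[ℂ] H) v = v := by
  rw [apply_eq_iff_mem_range] at hv ⊢
  exact (le_iff_range_le p q).1 h hv

/-- The complementary projection. -/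
def VonNeumannAlgebra.Proj.compl (p : A.Proj) : A.Proj := ⟨1 - p, p.2.one_sub⟩

theorem VonNeumannAlgebra.Proj.compl_apply (p : A.Proj) (v : H) :
    ((p.compl : A) : H →L[ℂ] H) v = v - ((p : A) : H →L[ℂ] H) v := rfl

theorem VonNeumannAlgebra.Proj.compl_le_of_compl_le {p q : A.Proj} (h : q.compl ≤ p) :
    p.compl ≤ q := by
  change (1 : A) - p ≤ q
  have h' : (1 : A) - q ≤ p := h
  rwa [sub_le_comm]

/-- The infimum is only known through its order property, whereas suprema have explicit ranges; so
it is bounded below by the complement of the supremum of the complements, which already fixes v. -/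
theorem VonNeumannAlgebra.Proj.sInf_apply_eq {S : Set A.Proj} {v : H}
    (h : ∀ q ∈ S, ((q : A) : H →L[ℂ] H) v = v) : (((sInf S : A.Proj) : A) : H →L[ℂ] H) v = v := by
  have hle : (sSup (compl '' S)).compl ≤ sInf S :=
    le_sInf fun q hq => compl_le_of_compl_le (le_sSup (Set.mem_image_of_mem _ hq))
  refine apply_eq_of_le hle ?_
  rw [compl_apply, sub_eq_self]
  change (spanRange (compl '' S)).starProjection v = 0
  rw [Submodule.starProjection_apply_eq_zero_iff, spanRange, Submodule.orthogonal_closure,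
    iSup_subtype', ← Submodule.iInf_orthogonal, Submodule.mem_iInf]
  rintro ⟨_, q, hq, rfl⟩ _ ⟨w, rfl⟩
  have := (q.compl.isStarProjection_coe.isSelfAdjoint.isSymmetric w v).trans
    (by rw [ContinuousLinearMap.coe_coe, compl_apply, h q hq, sub_self, inner_zero_right])
  exact this

theorem VonNeumannAlgebra.hasSum_inner_apply_eq_zero {φ : A →ₗ[ℂ] ℂ} {ι : Type*} {v : ι → H}
    (hφ : ∀ x : A, HasSum (fun i => ⟪v i, (x : H →L[ℂ] H) (v i)⟫_ℂ) (φ x)) {y : A} (hy : 0 ≤ y)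
    (h : φ y = 0) (i : ι) : (y : H →L[ℂ] H) (v i) = 0 := by
  refine apply_eq_zero_of_inner_eq_zero hy ?_
  have hs := hφ y
  rw [h, hasSum_zero_iff_of_nonneg fun i => inner_apply_nonneg hy (v i)] at hs
  exact congrFun hs i

theorem VonNeumannAlgebra.Proj.apply_eq_of_compress {φ : A →ₗ[ℂ] ℂ} {ι : Type*} {v : ι → H}
    (hφ : ∀ x : A, HasSum (fun i => ⟪v i, (x : H →L[ℂ] H) (v i)⟫_ℂ) (φ x)) (q : A.Proj)
    (h : ∀ x : A, φ x = φ ((q : A) * x * (q : A))) (i : ι) :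
    ((q : A) : H →L[ℂ] H) (v i) = v i := by
  -- Taking x = 1 gives φ(1) = φ(q); the positive element 1 - q then kills every vector representing
  -- φ.
  have h1 : φ (q.compl : A) = 0 := by
    have := h 1
    rw [mul_one, q.2.isIdempotentElem.eq] at this
    rw [compl, map_sub, this, sub_self]
  have := hasSum_inner_apply_eq_zero hφ q.compl.2.nonneg h1 i
  rw [compl_apply, sub_eq_zero] at this
  exact this.symm

theorem VonNeumannAlgebra.Proj.compress_of_apply_eq {φ : A →ₗ[ℂ] ℂ} {ι : Type*} {v : ι → H}
    (hφ : ∀ x : A, HasSum (fun i => ⟪v i, (x : H →L[ℂ] H) (v i)⟫_ℂ) (φ x)) (q : A.Proj)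
    (h : ∀ i, ((q : A) : H →L[ℂ] H) (v i) = v i) (x : A) : φ x = φ ((q : A) * x * (q : A)) := by
  refine (hφ x).unique (Eq.mp (congrArg (HasSum · _) (funext fun i => ?_)) (hφ (q * x * q)))
  change ⟪v i, ((q : A) : H →L[ℂ] H) ((x : H →L[ℂ] H) (((q : A) : H →L[ℂ] H) (v i)))⟫_ℂ = _
  rw [h]
  refine (q.isStarProjection_coe.isSelfAdjoint.isSymmetric _ _).symm.trans ?_
  rw [ContinuousLinearMap.coe_coe, h]

variable {P : A →CP A}

theorem IsStationaryState.stateSupport_le {φ : A →ₗ[ℂ] ℂ} (hφ : IsStationaryState P φ) :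
    stateSupport φ ≤ maxPositiveRecurrent P :=
  le_sSup ⟨{φ}, by simpa using hφ, by simp⟩

theorem maxPositiveRecurrent_le {q : A.Proj}
    (h : ∀ φ, IsStationaryState P φ → stateSupport φ ≤ q) : maxPositiveRecurrent P ≤ q :=
  sSup_le fun _ ⟨_, hΦ, hp⟩ => hp.trans (iSup₂_le fun φ hφ => h φ (hΦ φ hφ))

/-- The vectors representing φ are fixed by every projection competing in the definition of the
support, hence by their infimum and by the larger p_R. -/
theorem IsStationaryState.compress {φ : A →ₗ[ℂ] ℂ} (hφ : IsStationaryState P φ) (x : A) :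
    φ x = φ ((maxPositiveRecurrent P : A) * x * (maxPositiveRecurrent P : A)) := by
  obtain ⟨ι, v, hv⟩ := hφ.1.exists_hasSum_inner
  refine VonNeumannAlgebra.Proj.compress_of_apply_eq hv _ (fun i => ?_) x
  exact VonNeumannAlgebra.Proj.apply_eq_of_le hφ.stateSupport_le
    (VonNeumannAlgebra.Proj.sInf_apply_eq fun q hq =>
      VonNeumannAlgebra.Proj.apply_eq_of_compress hv q hq i)

/-- The orthogonal projection onto the kernel of an element of `A`. -/
noncomputable def VonNeumannAlgebra.kerProj (y : A) : A.Proj :=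
  ⟨⟨((y : H →L[ℂ] H).ker).starProjection, by
    rw [VonNeumannAlgebra.IsStarProjection.mem_iff isStarProjection_starProjection]
    intro z hz
    rw [Submodule.range_starProjection, Module.End.mem_invtSubmodule]
    intro v hv
    have hc := congrArg (fun T : H →L[ℂ] H => T v) (VonNeumannAlgebra.mem_commutant_iff.1 hz _ y.2)
    exact hc.trans ((congrArg z hv).trans (map_zero z))⟩,
  ⟨Subtype.ext isStarProjection_starProjection.isIdempotentElem,
    Subtype.ext isStarProjection_starProjection.isSelfAdjoint⟩⟩

theorem VonNeumannAlgebra.kerProj_apply_eq_iff (y : A) {v : H} :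
    ((kerProj y : A) : H →L[ℂ] H) v = v ↔ (y : H →L[ℂ] H) v = 0 :=
  Submodule.starProjection_eq_self_iff

/-- The stationary normal states are jointly faithful on the recurrent corner. -/
theorem mul_maxPositiveRecurrent_eq_zero {y : A} (hy : 0 ≤ y)
    (h : ∀ φ, IsStationaryState P φ → φ y = 0) : y * (maxPositiveRecurrent P : A) = 0 := by
  -- The vectors representing each stationary state lie in ker y, so the kernel projection dominates
  -- all their supports.
  have hle : maxPositiveRecurrent P ≤ VonNeumannAlgebra.kerProj y := by
    refine maxPositiveRecurrent_le fun φ hφ => sInf_le ?_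
    obtain ⟨ι, v, hv⟩ := hφ.1.exists_hasSum_inner
    exact VonNeumannAlgebra.Proj.compress_of_apply_eq hv _ fun i =>
      (VonNeumannAlgebra.kerProj_apply_eq_iff y).2
        (VonNeumannAlgebra.hasSum_inner_apply_eq_zero hv hy (h φ hφ) i)
  refine Subtype.ext (ContinuousLinearMap.ext fun v => ?_)
  exact (VonNeumannAlgebra.kerProj_apply_eq_iff y).1
    (VonNeumannAlgebra.Proj.apply_eq_of_le hle
      ((VonNeumannAlgebra.Proj.apply_eq_iff_mem_range _).2 ⟨v, rfl⟩))

theorem VonNeumannAlgebra.eq_of_inner_eq {x y : A}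
    (h : ∀ v : H, ‖v‖ = 1 → A.vectorFunctional v x = A.vectorFunctional v y) : x = y := by
  refine Subtype.ext (ContinuousLinearMap.coe_injective ((ext_inner_map _ _).1 fun v => ?_))
  rcases eq_or_ne v 0 with rfl | hv
  · simp
  have hn : (‖v‖ : ℂ) ≠ 0 := by simpa using hv
  have hu : v = (‖v‖ : ℂ) • ((‖v‖ : ℂ)⁻¹ • v) := by rw [smul_smul, mul_inv_cancel₀ hn, one_smul]
  have h1 : ⟪(‖v‖ : ℂ)⁻¹ • v, (x : H →L[ℂ] H) ((‖v‖ : ℂ)⁻¹ • v)⟫_ℂ =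
      ⟪(‖v‖ : ℂ)⁻¹ • v, (y : H →L[ℂ] H) ((‖v‖ : ℂ)⁻¹ • v)⟫_ℂ :=
    h ((‖v‖ : ℂ)⁻¹ • v) (norm_smul_inv_norm (𝕜 := ℂ) hv)
  have h2 : ⟪v, (x : H →L[ℂ] H) v⟫_ℂ = ⟪v, (y : H →L[ℂ] H) v⟫_ℂ := by
    rw [hu]
    simp only [map_smul (_ : H →L[ℂ] H) (‖v‖ : ℂ), inner_smul_left _ _ (‖v‖ : ℂ),
      inner_smul_right _ _ (‖v‖ : ℂ), h1]
  have := congrArg (starRingEnd ℂ) h2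
  rwa [inner_conj_symm, inner_conj_symm] at this

/-- An idempotent Markov operator only depends on the compression to the recurrent corner. -/
theorem IsMarkov.apply_compress (hP : IsMarkov P) (hidem : ∀ x, P (P x) = P x) (x : A) :
    P ((maxPositiveRecurrent P : A) * x * (maxPositiveRecurrent P : A)) = P x := by
  refine VonNeumannAlgebra.eq_of_inner_eq fun v hv => ?_
  have : IsStationaryState P (A.vectorFunctional v ∘ₗ P.toLinearMap) :=
    ⟨hP.normal _ (A.isNormalState_vectorFunctional hv), fun x =>
      congrArg (A.vectorFunctional v) (hidem x)⟩
  exact (this.compress x).symm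

end Support

/-- Needed because the corner is a subalgebra of A whose unit is p_R, in general not the unit of A.
-/
theorem exists_basis_orthogonal_idempotents_of_left_unit (K : Type*) {R : Type*} [Field K]
    [IsAlgClosed K] [NonUnitalCommRing R] [Module K R] [IsScalarTower K R R] [SMulCommClass K R R]
    [FiniteDimensional K R] (u : R) (hu : ∀ x, u * x = x) (hred : ∀ x : R, x * x = 0 → x = 0) :
    ∃ (n : ℕ) (e : Module.Basis (Fin n) K R),
      (∀ i j, e i * e j = if i = j then e i else 0) ∧ ∑ i, e i = u := by
  let : CommRing R := { (inferInstance : NonUnitalCommRing R) with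
    one := u
    one_mul := hu
    mul_one := fun x => (mul_comm x u).trans (hu x) }
  let : Algebra K R := Algebra.ofModule smul_mul_assoc mul_smul_comm
  have : IsReduced R := (isReduced_iff_pow_one_lt 2 one_lt_two).2 fun x hx =>
    hred x (by rwa [pow_two] at hx)
  exact exists_basis_orthogonal_idempotents K R

/-! ### The Schwarz inequality -/

theorem CStarMatrix.apply_self_nonneg {n R : Type*} [Fintype n] [CStarAlgebra R]
    [PartialOrder R] [StarOrderedRing R] {M : CStarMatrix n n R} (hM : 0 ≤ M) (i : n) :
    0 ≤ M i i := by
  rw [StarOrderedRing.nonneg_iff] at hM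
  induction hM using AddSubmonoid.closure_induction with
  | mem M hM =>
    obtain ⟨N, rfl⟩ := hM
    exact Finset.sum_nonneg fun k _ => star_mul_self_nonneg (N k i)
  | zero => exact le_rfl
  | add M N _ _ hM hN => exact add_nonneg hM hN

/-- A form of the Schwarz inequality for unital completely positive maps. -/
theorem CompletelyPositiveMap.schwarz_nonneg {R S : Type*} [CStarAlgebra R] [PartialOrder R]
    [StarOrderedRing R] [CStarAlgebra S] [PartialOrder S] [StarOrderedRing S] (P : R →CP S)
    (h1 : P 1 = 1) {b : R} (hb : IsSelfAdjoint b) {c q : S} (hc : IsSelfAdjoint c)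
    (hq : IsSelfAdjoint q) :
    0 ≤ c * c - c * P b * q - q * P b * c + q * P (b * b) * q := by
  -- N⋆N has rows (1, b) and (b, b²). Conjugating its entrywise image by the column (-c, q) puts the
  -- required expression in the (0, 0) entry.
  let N : CStarMatrix (Fin 2) (Fin 2) R := CStarMatrix.ofMatrix !![1, b; 0, 0]
  let W : CStarMatrix (Fin 2) (Fin 2) S := CStarMatrix.ofMatrix !![-c, 0; q, 0]
  have h := CStarMatrix.apply_self_nonneg
    (star_left_conjugate_nonneg (P.map_cstarMatrix_nonneg _ (star_mul_self_nonneg N)) W) 0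
  refine h.trans_eq ?_
  simp only [CStarMatrix.mul_apply, Fin.sum_univ_two, CStarMatrix.map_apply, CStarMatrix.star_apply,
    N, W, CStarMatrix.ofMatrix_apply, Matrix.of_apply, Matrix.cons_val_zero, Matrix.cons_val_one,
    Matrix.cons_val', Matrix.cons_val_fin_one, star_one, star_zero, star_neg, hb.star_eq,
    hc.star_eq, hq.star_eq, add_zero, mul_one, one_mul, h1, zero_mul]
  noncomm_ring

/-! ### The recurrent corner -/

section Corner

variable {H : Type u} [NormedAddCommGroup H] [InnerProductSpace ℂ H] [CompleteSpace H]
  {A : VonNeumannAlgebra H} {P : A →CP A}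

theorem mem_compressedRange {b : A} : b ∈ compressedRange P ↔
    ∃ x, (maxPositiveRecurrent P : A) * P x * (maxPositiveRecurrent P : A) = b := by
  simp only [compressedRange, Submodule.mem_map, LinearMap.mem_range]
  constructor
  · rintro ⟨_, ⟨x, rfl⟩, rfl⟩
    exact ⟨x, rfl⟩
  · rintro ⟨x, rfl⟩
    exact ⟨_, ⟨x, rfl⟩, rfl⟩

theorem mul_eq_of_mem_compressedRange {b : A} (hb : b ∈ compressedRange P) :
    (maxPositiveRecurrent P : A) * b = b := by
  obtain ⟨x, rfl⟩ := mem_compressedRange.1 hb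
  rw [← mul_assoc, ← mul_assoc, (maxPositiveRecurrent P).2.isIdempotentElem.eq]

theorem eq_mul_of_mem_compressedRange {b : A} (hb : b ∈ compressedRange P) :
    b * (maxPositiveRecurrent P : A) = b := by
  obtain ⟨x, rfl⟩ := mem_compressedRange.1 hb
  rw [mul_assoc, (maxPositiveRecurrent P).2.isIdempotentElem.eq]

theorem star_mem_compressedRange {b : A} (hb : b ∈ compressedRange P) :
    star b ∈ compressedRange P := by
  obtain ⟨x, rfl⟩ := mem_compressedRange.1 hb
  refine mem_compressedRange.2 ⟨star x, ?_⟩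
  rw [star_mul, star_mul, (maxPositiveRecurrent P).2.isSelfAdjoint.star_eq, map_star, mul_assoc]

variable (hP : IsMarkov P) (hidem : ∀ x : A, P (P x) = P x)
include hP

theorem maxPositiveRecurrent_mem_compressedRange :
    (maxPositiveRecurrent P : A) ∈ compressedRange P :=
  mem_compressedRange.2 ⟨1, by
    rw [hP.map_one, mul_one, (maxPositiveRecurrent P).2.isIdempotentElem.eq]⟩

include hidem

theorem compress_apply_of_mem_compressedRange {b : A} (hb : b ∈ compressedRange P) :
    (maxPositiveRecurrent P : A) * P b * (maxPositiveRecurrent P : A) = b := by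
  obtain ⟨x, rfl⟩ := mem_compressedRange.1 hb
  rw [hP.apply_compress hidem, hidem]

/-- Schwarz with c = b and q = p_R makes pP(b²)p - b² positive; joint faithfulness of the stationary
states forces it to vanish. -/
theorem mul_self_mem_compressedRange {b : A} (hb : b ∈ compressedRange P)
    (hsa : IsSelfAdjoint b) : b * b ∈ compressedRange P := by
  set p : A := (maxPositiveRecurrent P : A) with hp
  have hpb : p * b = b := mul_eq_of_mem_compressedRange hb
  have hbp : b * p = b := eq_mul_of_mem_compressedRange hb
  have hPb : p * P b * p = b := compress_apply_of_mem_compressedRange hP hidem hb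
  have h1 : b * P b * p = b * b := by
    calc b * P b * p = b * p * P b * p := by rw [hbp]
      _ = b * (p * P b * p) := by simp only [mul_assoc]
      _ = b * b := by rw [hPb]
  have h2 : p * P b * b = b * b := by
    calc p * P b * b = p * P b * (p * b) := by rw [hpb]
      _ = p * P b * p * b := by rw [mul_assoc _ p b]
      _ = b * b := by rw [hPb]
  have hy := P.schwarz_nonneg hP.map_one hsa hsa (maxPositiveRecurrent P).2.isSelfAdjoint
  rw [← hp, h1, h2, sub_self, zero_sub, neg_add_eq_sub] at hy
  -- Compression is invisible to P and P² = P, so both terms have the image P(b²).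
  have hPy : P (p * P (b * b) * p - b * b) = 0 := by
    rw [map_sub, hP.apply_compress hidem, hidem, sub_self]
  have hz := mul_maxPositiveRecurrent_eq_zero (P := P) hy fun φ hφ => by
    rw [← hφ.2, hPy, map_zero]
  rw [← hp, sub_mul, mul_assoc, (maxPositiveRecurrent P).2.isIdempotentElem.eq, mul_assoc b, hbp,
    sub_eq_zero] at hz
  exact mem_compressedRange.2 ⟨_, hz⟩

variable (hcomm : ∀ x ∈ compressedRange P, ∀ y ∈ compressedRange P, x * y = y * x)
include hcomm

/-- Polarization turns squares into products of commuting self-adjoint elements; real and imaginary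
parts give the general case. -/
theorem mul_mem_compressedRange {b c : A} (hb : b ∈ compressedRange P)
    (hc : c ∈ compressedRange P) : b * c ∈ compressedRange P := by
  have hre {x : A} (hx : x ∈ compressedRange P) : (realPart x : A) ∈ compressedRange P := by
    rw [realPart_apply_coe]
    exact Submodule.smul_of_tower_mem _ _ (add_mem hx (star_mem_compressedRange hx))
  have him {x : A} (hx : x ∈ compressedRange P) : (imaginaryPart x : A) ∈ compressedRange P := by
    rw [imaginaryPart_apply_coe]
    exact Submodule.smul_mem _ _
      (Submodule.smul_of_tower_mem _ _ (sub_mem hx (star_mem_compressedRange hx)))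
  have key {x y : A} (hx : x ∈ compressedRange P) (hy : y ∈ compressedRange P)
      (hxs : IsSelfAdjoint x) (hys : IsSelfAdjoint y) : x * y ∈ compressedRange P := by
    have h : x * y = (2 : ℂ)⁻¹ • ((x + y) * (x + y) - x * x - y * y) := by
      have : (x + y) * (x + y) - x * x - y * y = (2 : ℂ) • (x * y) := by
        rw [add_mul, mul_add, mul_add, hcomm y hy x hx, two_smul]
        abel
      rw [this, smul_smul, inv_mul_cancel₀ two_ne_zero, one_smul]
    rw [h]
    exact Submodule.smul_mem _ _ (sub_mem (sub_mem
      (mul_self_mem_compressedRange hP hidem (add_mem hx hy) (hxs.add hys))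
      (mul_self_mem_compressedRange hP hidem hx hxs)) (mul_self_mem_compressedRange hP hidem hy hys))
  rw [← realPart_add_I_smul_imaginaryPart b, ← realPart_add_I_smul_imaginaryPart c, add_mul,
    mul_add, mul_add, smul_mul_smul_comm, smul_mul_assoc, mul_smul_comm]
  have hbr := key (hre hb) (hre hc) (realPart b).2 (realPart c).2
  have hri := key (hre hb) (him hc) (realPart b).2 (imaginaryPart c).2
  have hir := key (him hb) (hre hc) (imaginaryPart b).2 (realPart c).2
  have hii := key (him hb) (him hc) (imaginaryPart b).2 (imaginaryPart c).2
  exact add_mem (add_mem hbr (Submodule.smul_mem _ _ hri))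
    (add_mem (Submodule.smul_mem _ _ hir) (Submodule.smul_mem _ _ hii))

theorem exists_orthogonal_projections_compressedRange
    (hfin : FiniteDimensional ℂ (compressedRange P)) :
    ∃ (n : ℕ) (e : Fin n → A), LinearIndependent ℂ e ∧ (∀ i, IsStarProjection (e i)) ∧
      (∀ i j, i ≠ j → e i * e j = 0) ∧ ∑ i, e i = (maxPositiveRecurrent P : A) ∧
      (∀ i, e i ∈ compressedRange P) ∧
      ∀ b ∈ compressedRange P, ∃ c : Fin n → ℂ, b = ∑ i, c i • e i := by
  let B : NonUnitalSubalgebra ℂ A := { compressedRange P with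
    mul_mem' := fun ha hb => mul_mem_compressedRange hP hidem hcomm ha hb }
  let : NonUnitalCommRing B := { (inferInstance : NonUnitalRing B) with
    mul_comm := fun x y => Subtype.ext (hcomm x x.2 y y.2) }
  have : FiniteDimensional ℂ B := hfin
  obtain ⟨n, e, he, hsum⟩ := exists_basis_orthogonal_idempotents_of_left_unit ℂ
    (⟨maxPositiveRecurrent P, maxPositiveRecurrent_mem_compressedRange hP⟩ : B)
    (fun x => Subtype.ext (mul_eq_of_mem_compressedRange x.2)) (fun x hx => by
      have hx' : (x : A) * x = 0 := congrArg Subtype.val hx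
      -- Reducedness: if x² = 0 then, x being normal, (x⋆x)² = 0, and the C⋆-identity applied twice
      -- gives x = 0.
      have hc := hcomm _ x.2 _ (star_mem_compressedRange x.2)
      refine Subtype.ext ((CStarRing.star_mul_self_eq_zero_iff (x : A)).1 ?_)
      refine (CStarRing.star_mul_self_eq_zero_iff _).1 ?_
      rw [star_mul, star_star, mul_assoc, ← mul_assoc (x : A), hc, mul_assoc, hx', mul_zero,
        mul_zero])
  have hmul (i j) : (e i : A) * e j = if i = j then (e i : A) else 0 := by
    have h := congrArg Subtype.val (he i j)
    split_ifs at h ⊢ <;> exact h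
  refine ⟨n, fun i => e i, e.linearIndependent.map' (Submodule.subtype (compressedRange P))
    (Submodule.ker_subtype _), fun i => ?_, fun i j hij => by rw [hmul, if_neg hij], ?_,
    fun i => (e i).2, fun b hb => ⟨e.repr ⟨b, hb⟩, ?_⟩⟩
  -- A normal idempotent is self-adjoint; normality comes from commutativity of the corner.
  · refine isStarProjection_iff_isIdempotentElem_and_isStarNormal.2 ⟨by
      rw [IsIdempotentElem, hmul, if_pos rfl], ⟨?_⟩⟩
    exact hcomm _ (star_mem_compressedRange (e i).2) _ (e i).2
  · have h := congrArg B.subtype hsum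
    rwa [map_sum] at h
  · have h := congrArg (Submodule.subtype (compressedRange P)) (e.sum_repr ⟨b, hb⟩)
    rw [map_sum] at h
    exact h.symm

end Corner

/-! ### The Holevo representation. -/

theorem mainTheorem12 {H : Type u} [NormedAddCommGroup H] [InnerProductSpace ℂ H] [CompleteSpace H]
    (A : VonNeumannAlgebra H) (P : A →CP A) (hP : IsMarkov P) (hidem : ∀ x : A, P (P x) = P x)
    (hfin : FiniteDimensional ℂ (compressedRange P))
    (hcomm : ∀ x ∈ compressedRange P, ∀ y ∈ compressedRange P, x * y = y * x) :
    ∃ (n : ℕ) (φ : Fin n → (A →ₗ[ℂ] ℂ)) (a : Fin n → A),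
      IsHolevoRepresentation P φ a ∧ LinearIndependent ℂ a ∧ LinearIndependent ℂ φ := by
  obtain ⟨n, e, hli, hproj, horth, hsum, hmem, hspan⟩ :=
    exists_orthogonal_projections_compressedRange hP hidem hcomm hfin
  set p : A := (maxPositiveRecurrent P : A) with hp
  -- A unit vector in the range of each e_i gives a vector state reading off the e_i-coordinate in
  -- the corner.
  have hne (i) : ∃ v : H, ‖v‖ = 1 ∧ (e i : H →L[ℂ] H) v = v := by
    obtain ⟨w, hw⟩ : ∃ w, (e i : H →L[ℂ] H) w ≠ 0 := by
      by_contra! h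
      exact hli.ne_zero i (Subtype.ext (ContinuousLinearMap.ext h))
    refine ⟨(‖(e i : H →L[ℂ] H) w‖ : ℂ)⁻¹ • (e i : H →L[ℂ] H) w, norm_smul_inv_norm hw, ?_⟩
    rw [map_smul]
    congr 1
    exact congrArg (fun T : A => (T : H →L[ℂ] H) w) (hproj i).isIdempotentElem
  choose v hv hev using hne
  have hself (q : A) (hq : IsSelfAdjoint q) (x y : H) :
      ⟪(q : H →L[ℂ] H) x, y⟫_ℂ = ⟪x, (q : H →L[ℂ] H) y⟫_ℂ :=
    (show IsSelfAdjoint (q : H →L[ℂ] H) from congrArg Subtype.val hq).isSymmetric x y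
  have hvec (i j) : A.vectorFunctional (v i) (e j) = if i = j then 1 else 0 := by
    change ⟪v i, (e j : H →L[ℂ] H) (v i)⟫_ℂ = _
    split_ifs with hij
    · rw [← hij, hev, inner_self_eq_norm_sq_to_K, hv, RCLike.ofReal_one, one_pow]
    · have : (e j : H →L[ℂ] H) (v i) = 0 := by
        rw [← hev i]
        exact congrArg (fun T : A => (T : H →L[ℂ] H) (v i)) (horth j i (Ne.symm hij))
      rw [this, inner_zero_right]
  have hpv (i) : (p : H →L[ℂ] H) (v i) = v i := by
    conv_lhs => rw [← hev i]
    exact (congrArg (fun T : A => (T : H →L[ℂ] H) (v i))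
      (mul_eq_of_mem_compressedRange (hmem i))).trans (hev i)
  have hcompr (i) (x : A) : A.vectorFunctional (v i) (p * x * p) = A.vectorFunctional (v i) x := by
    change ⟪v i, (p : H →L[ℂ] H) ((x : H →L[ℂ] H) ((p : H →L[ℂ] H) (v i)))⟫_ℂ = _
    rw [hpv, ← hself p (maxPositiveRecurrent P).2.isSelfAdjoint, hpv]
    rfl
  have hcoord (x : A) : p * P x * p = ∑ i, A.vectorFunctional (v i) (P x) • e i := by
    obtain ⟨c, hc⟩ := hspan _ (mem_compressedRange.2 ⟨x, rfl⟩)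
    rw [← hp] at hc
    rw [hc]
    refine Finset.sum_congr rfl fun i _ => ?_
    rw [← hcompr, hc, map_sum]
    simp [hvec]
  have hPe (j) : p * P (e j) * p = e j := compress_apply_of_mem_compressedRange hP hidem (hmem j)
  refine ⟨n, fun i => A.vectorFunctional (v i) ∘ₗ P.toLinearMap, fun i => P (e i),
    ⟨fun i => hP.normal _ (A.isNormalState_vectorFunctional (hv i)), fun i =>
      map_nonneg P (hproj i).nonneg, ?_, fun x => ?_⟩, ?_, ?_⟩
  · have := hP.apply_compress hidem 1
    rw [mul_one, (maxPositiveRecurrent P).2.isIdempotentElem.eq, ← hp, hP.map_one] at this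
    rw [← map_sum, hsum, this]
  · have := hP.apply_compress hidem (P x)
    rw [← hp, hcoord, hidem, map_sum] at this
    rw [← this]
    exact Finset.sum_congr rfl fun i _ => map_smul P _ _
  -- Compression by p maps P(e_i) back to e_i.
  · refine LinearIndependent.of_comp (LinearMap.mulLeftRight ℂ (p, p)) ?_
    have hcomp : LinearMap.mulLeftRight ℂ (p, p) ∘ (fun i => P (e i)) = e := funext hPe
    rwa [hcomp]
  -- The states are dual to the projections: φ_i(e_j) = δ_ij.
  · rw [Fintype.linearIndependent_iff]
    intro c hc j
    have h := congrArg (fun f : A →ₗ[ℂ] ℂ => f (e j)) hc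
    have hPv (i) : A.vectorFunctional (v i) (P (e j)) = if i = j then 1 else 0 := by
      rw [← hcompr, hPe, hvec]
    have hPv' (i) : (A.vectorFunctional (v i) ∘ₗ P.toLinearMap) (e j) = if i = j then 1 else 0 :=
      hPv i
    simpa [-LinearMap.coe_comp, hPv'] using h
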